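/- Let $f:[a,b]\to[a,b]$, $a<b$, be a unimodal map: $f$ is continuous, $f(a)=f(b)=a$ or $f(a)=f(b)=b$, and there is $c\in(a,b)$ such that $f$ is strictly increasing (or decreasing) on $[a,c]$ and strictly decreasing (respectively, increasing) on $[c,b]$. Write $\omega_f(x)$ for the set of limit points of the sequence $(f^n(x))_{n\ge0}$, and call $\{x:\omega_f(x)\subset A\}$ the basin of $A\subset[a,b]$. For $\varepsilon>0$, an $\varepsilon$-chain from $x$ to $y$ is a sequence $x=x_0,x_1,\dots,x_n,x_{n+1}=y$ ($n\ge 0$) with $|f(x_i)-x_{i+1}|<\varepsilon$ for $i=0,\dots,n$. A point $x$ is chain-recurrent if for every $\varepsilon>0$ there is an $\varepsilon$-chain from $x$ to $x$; two chain-recurrent points $x,y$ are equivalent if for every $\varepsilon>0$ there are $\varepsilon$-chains from $x$ to $y$ and from $y$ to $x$. The equivalence classes are called nodes. The Conley graph $\Gamma_f$ is the directed graph whose vertices are the nodes, with an edge from $N_1$ to $N_2$ if arbitrarily close to $N_1$ there are points $x$ with $\omega_f(x)\subset N_2$. An attractor is a closed set $A$ with $f(A)\subset A$ whose basin has positive Lebesgue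 measure and such that no closed $A'\subsetneq A$ with $f(A')\subset A'$ has a basin differing from that of $A$ only by a null set. Assume that $f$ is T-unimodal, that is: (1) $f$ has no wandering interval, i.e. there is no nondegenerate closed interval $J\subset[a,b]$ such that the sets $f^k(J)$, $k\ge0$, are pairwise disjoint and $J$ is not contained in the basin of a periodic orbit; (2) no periodic orbit of $f$ is an attractor; (3) $f$ has finitely many nodes. Then $\Gamma_f$ is a finite tower: it has finitely many nodes, it is acyclic (apart from the loop at each node, it has no directed cycle), and any two distinct nodes are joined by an edge. In particular, its nodes can be listed as $N_0,\dots,N_p$ without repetition so that there is an edge from $N_i$ to $N_j$ if and only if $i\le j$. -/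

import Mathlib

namespace Conley

open Set Filter MeasureTheory

/-! ### The graph of a discrete dynamical system -/

section Graph

variable {X : Type*} [MetricSpace X]

/-- There is an `ε`-chain from `x` to `y`: points `u 0 = x, u 1, …, u n, u (n + 1) = y` with
`dist (f (u i)) (u (i + 1)) < ε` for `i = 0, …, n`. -/
def HasChain (f : X → X) (ε : ℝ) (x y : X) : Prop :=
  ∃ (n : ℕ) (u : ℕ → X), u 0 = x ∧ u (n + 1) = y ∧ ∀ i ≤ n, dist (f (u i)) (u (i + 1)) < ε

/-- `x` is upstream from `y` (and `y` is downstream from `x`). -/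
def Upstream (f : X → X) (x y : X) : Prop :=
  ∀ ε : ℝ, 0 < ε → HasChain f ε x y

/-- The set of chain-recurrent points. -/
def chainRecurrentSet (f : X → X) : Set X :=
  {x | Upstream f x x}

theorem HasChain.trans {f : X → X} {ε : ℝ} {x y z : X} (h₁ : HasChain f ε x y)
    (h₂ : HasChain f ε y z) : HasChain f ε x z := by
  obtain ⟨n, u, hu0, hun, hu⟩ := h₁
  obtain ⟨m, v, hv0, hvm, hv⟩ := h₂
  refine ⟨n + 1 + m, fun i => if i ≤ n then u i else v (i - (n + 1)), by simp [hu0], ?_, ?_⟩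
  · have h : ¬ (n + 1 + m + 1 ≤ n) := by omega
    have h' : n + 1 + m + 1 - (n + 1) = m + 1 := by omega
    simp only [h, h', if_false, hvm]
  · intro i hi
    rcases lt_trichotomy i n with h | h | h
    · have h1 : i ≤ n := h.le
      have h2 : i + 1 ≤ n := h
      simpa only [h1, h2, if_true] using hu i h1
    · subst h
      have h2 : ¬ (i + 1 ≤ i) := by omega
      have := hu i le_rfl
      simp only [le_refl, if_true, h2, if_false, Nat.sub_self, hv0]
      rwa [hun] at this
    · have h1 : ¬ (i ≤ n) := by omega
      have h2 : ¬ (i + 1 ≤ n) := by omega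
      have h3 : i + 1 - (n + 1) = i - (n + 1) + 1 := by omega
      simp only [h1, h2, if_false, h3]
      exact hv _ (by omega)

theorem Upstream.trans {f : X → X} {x y z : X} (h₁ : Upstream f x y) (h₂ : Upstream f y z) :
    Upstream f x z :=
  fun ε hε => (h₁ ε hε).trans (h₂ ε hε)

/-- Two chain-recurrent points are equivalent if each is upstream from the other. -/
def chainSetoid (f : X → X) : Setoid (chainRecurrentSet f) where
  r x y := Upstream f x y ∧ Upstream f y x
  iseqv :=
    { refl := fun x => ⟨x.2, x.2⟩
      symm := fun h => ⟨h.2, h.1⟩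
      trans := fun h h' => ⟨h.1.trans h'.1, h'.2.trans h.2⟩ }

/-- The nodes: equivalence classes of chain-recurrent points. -/
def Node (f : X → X) : Type _ :=
  Quotient (chainSetoid f)

/-- A node as a subset of the phase space. -/
def Node.carrier {f : X → X} (N : Node f) : Set X :=
  {x | ∃ h : x ∈ chainRecurrentSet f, Quotient.mk (chainSetoid f) ⟨x, h⟩ = N}

/-- The limit set of the forward orbit of `x`. -/
def limitSet (f : X → X) (x : X) : Set X :=
  omegaLimit atTop (fun (n : ℕ) (y : X) => f^[n] y) {x}

/-- The Conley graph: there is an edge from `N₁` to `N₂` if arbitrarily close to `N₁` there are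
points whose limit set is contained in `N₂`. -/
def conleyGraph (f : X → X) : Digraph (Node f) where
  Adj N₁ N₂ := ∀ ε : ℝ, 0 < ε →
    ∃ x : X, (∃ y ∈ N₁.carrier, dist x y < ε) ∧ limitSet f x ⊆ N₂.carrier

end Graph

/-- A directed graph without directed cycles other than loops: two vertices that can be reached
from each other are equal. (In a Conley graph every node trivially has a loop.) -/
def IsAcyclic {V : Type*} (G : Digraph V) : Prop :=
  ∀ u v : V, Relation.ReflTransGen G.Adj u v → Relation.ReflTransGen G.Adj v u → u = v

/-- A tower: an acyclic directed graph with an edge between every pair of distinct vertices. -/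
def IsTower {V : Type*} (G : Digraph V) : Prop :=
  IsAcyclic G ∧ ∀ u v : V, u ≠ v → G.Adj u v ∨ G.Adj v u

/-! ### Attractors -/

section Attractor

variable {X : Type*} [MetricSpace X]

/-- The basin of attraction of a set. -/
def basin (f : X → X) (A : Set X) : Set X :=
  {x | limitSet f x ⊆ A}

/-- The orbit of a point. -/
def orbit (f : X → X) (x : X) : Set X :=
  range fun n : ℕ => f^[n] x

/-- Attractors in the sense of Milnor, with respect to a reference measure `μ`. -/
structure IsAttractor [MeasurableSpace X] (μ : Measure X) (f : X → X) (A : Set X) : Prop where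
  isClosed : IsClosed A
  mapsTo : MapsTo f A A
  basin_pos : 0 < μ (basin f A)
  minimal : ¬ ∃ A' : Set X, A' ⊂ A ∧ IsClosed A' ∧ MapsTo f A' A' ∧
    μ (basin f A \ basin f A') = 0

end Attractor

/-! ### T-unimodal maps of a compact interval -/

section Interval

variable {a b : ℝ}

/-- Unimodal maps of `[a, b]`, with a turning point that is either a maximum or a minimum. -/
structure IsUnimodal (hab : a < b) (f : Icc a b → Icc a b) : Prop where
  continuous : Continuous f
  boundary :
    ((f ⟨a, left_mem_Icc.mpr hab.le⟩ : ℝ) = a ∧ (f ⟨b, right_mem_Icc.mpr hab.le⟩ : ℝ) = a) ∨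
    ((f ⟨a, left_mem_Icc.mpr hab.le⟩ : ℝ) = b ∧ (f ⟨b, right_mem_Icc.mpr hab.le⟩ : ℝ) = b)
  turning : ∃ c : Icc a b, a < (c : ℝ) ∧ (c : ℝ) < b ∧
    ((StrictMonoOn f (Iic c) ∧ StrictAntiOn f (Ici c)) ∨
      (StrictAntiOn f (Iic c) ∧ StrictMonoOn f (Ici c)))

/-- A wandering interval: a nondegenerate closed interval whose iterates are mutually disjoint and
that is not contained in the basin of a periodic orbit. -/
def IsWanderingInterval (f : Icc a b → Icc a b) (J : Set (Icc a b)) : Prop :=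
  (∃ u v : Icc a b, u < v ∧ J = Icc u v) ∧
  Pairwise (fun k l : ℕ => Disjoint (f^[k] '' J) (f^[l] '' J)) ∧
  ¬ ∃ x ∈ Function.periodicPts f, J ⊆ basin f (orbit f x)

/-- Lebesgue measure on `[a, b]`. -/
noncomputable def lebesgue (a b : ℝ) : Measure (Icc a b) :=
  Measure.comap Subtype.val volume

/-- T-unimodal maps: unimodal maps with no wandering interval, no attracting cycle and finitely
many nodes. -/
structure IsTUnimodal (hab : a < b) (f : Icc a b → Icc a b) : Prop where
  unimodal : IsUnimodal hab f
  no_wandering : ∀ J : Set (Icc a b), ¬ IsWanderingInterval f J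
  no_attracting_cycle : ∀ x ∈ Function.periodicPts f,
    ¬ IsAttractor (lebesgue a b) f (orbit f x)
  finite_nodes : Finite (Node f)

end Interval

end Conley

namespace Conley

open Set Filter MeasureTheory Topology

/-! ### Chains, nodes and the order that edges induce on nodes. -/

section Chains

variable {X : Type*} [MetricSpace X] {f : X → X}

/-! Everything rests on the turning point `c`. Arbitrarily close to any node there are points `x`
with `f^[n] x = c` (`exists_iterate_eq_turning`), hence with `f^[n + 1] x = f c`. Nodes lie in the
range of `f`, so all of them are on one side of the extreme value `f c`. Given two nodes, the one
whose extreme point is nearer to `f c` has that point `q` between `f c` and every point of the other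
node `N`. A short interval from a point of `N` to a nearby preimage of `c` is mapped by `f^[n + 1]`
onto a connected set containing a point of `N` and `f c`, hence `q`. So some point near `N` lands on
`q`, which gives an edge. Edges imply chains, so mutual edges identify nodes; a total relation of
this kind is a linear order.

To find the preimages, suppose a neighbourhood `V` of `N` has none. Absence of wandering intervals
and attracting cycles forces a component of `V` to meet itself again under iteration, and iterates
are monotone there. A moving point would then span an interval attracted by a cycle, so such a
component, or an iterate of it, consists of periodic points. This yields a component of `V` that
lies in `N`, is open and closed, and so is the whole interval, contradicting `c ∉ V`. -/

theorem HasChain.exists_head {ε : ℝ} {x y : X} (h : HasChain f ε x y) :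
    dist (f x) y < ε ∨ ∃ z, dist (f x) z < ε ∧ HasChain f ε z y := by
  obtain ⟨n, u, rfl, rfl, hu⟩ := h
  rcases n with _ | n
  · exact .inl (hu 0 le_rfl)
  · exact .inr ⟨u 1, hu 0 (by omega), n, fun i => u (i + 1), rfl, rfl, fun i hi => hu (i + 1) (by omega)⟩

theorem HasChain.single {ε : ℝ} {x y : X} (h : dist (f x) y < ε) : HasChain f ε x y :=
  ⟨0, fun i => if i = 0 then x else y, by simp, by simp, by
    intro i hi
    obtain rfl : i = 0 := by omega
    simpa using h⟩

theorem HasChain.cons {ε : ℝ} {x y z : X} (h : dist (f x) z < ε) (h' : HasChain f ε z y) :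
    HasChain f ε x y :=
  (HasChain.single h).trans h'

theorem HasChain.mono {ε δ : ℝ} (hεδ : ε ≤ δ) {x y : X} (h : HasChain f ε x y) :
    HasChain f δ x y := by
  obtain ⟨n, u, h0, hn, hu⟩ := h
  exact ⟨n, u, h0, hn, fun i hi => (hu i hi).trans_le hεδ⟩

/-- The start of a chain enters only through its image, so only `f x` and `f x'` need to be close.
-/
theorem HasChain.change_head {ε : ℝ} {x x' y : X} (h : HasChain f (ε / 2) x' y)
    (hx : dist (f x) (f x') < ε / 2) : HasChain f ε x y := by
  have hε : 0 ≤ ε / 2 := dist_nonneg.trans hx.le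
  rcases h.exists_head with h | ⟨z, hz, h⟩
  · exact .single (by linarith [dist_triangle (f x) (f x') y])
  · exact .cons (by linarith [dist_triangle (f x) (f x') z]) (h.mono (by linarith))

theorem HasChain.change_tail {ε : ℝ} {x y y' : X} (h : HasChain f (ε / 2) x y')
    (hy : dist y' y < ε / 2) : HasChain f ε x y := by
  have hε : 0 ≤ ε / 2 := dist_nonneg.trans hy.le
  obtain ⟨n, u, h0, hn, hu⟩ := h
  refine ⟨n, fun i => if i ≤ n then u i else y, by simp [h0], by simp, fun i hi => ?_⟩
  rcases hi.lt_or_eq with hi' | rfl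
  · have := hu i hi
    simp only [hi, if_true, Nat.succ_le_iff.mpr hi']
    linarith
  · have := hu i hi
    rw [hn] at this
    simp only [le_refl, if_true, Nat.not_succ_le_self, if_false]
    linarith [dist_triangle (f (u i)) y' y]

theorem HasChain.of_iterate {ε : ℝ} {n : ℕ} {x y : X}
    (h : dist (f^[n + 1] x) y < ε) : HasChain f ε x y := by
  induction n generalizing x with
  | zero => exact .single h
  | succ n ih =>
    exact .cons (z := f x) (by simpa using dist_nonneg.trans_lt h) (ih h)

theorem upstream_iterate (n : ℕ) (x : X) : Upstream f x (f^[n + 1] x) :=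
  fun ε hε => .of_iterate (n := n) (by simpa using hε)

theorem mem_limitSet {x w : X} : w ∈ limitSet f x ↔ MapClusterPt w atTop fun n => f^[n] x :=
  mem_omegaLimit_singleton_iff_mapClusterPt ..

theorem upstream_of_mem_limitSet {x w : X} (h : w ∈ limitSet f x) : Upstream f x w := by
  intro ε hε
  have h1 := ((mem_limitSet.mp h).frequently (Metric.ball_mem_nhds w hε)).and_eventually
    (eventually_ge_atTop 1)
  obtain ⟨n, hn, hn1⟩ := h1.exists
  obtain ⟨m, rfl⟩ := Nat.exists_eq_add_of_le' hn1
  exact .of_iterate hn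

theorem upstream_self_of_mem_limitSet (hf : Continuous f) {x w : X} (h : w ∈ limitSet f x) :
    Upstream f w w := by
  intro ε hε
  obtain ⟨δ, hδ, H⟩ := Metric.continuous_iff.mp hf w (ε / 2) (half_pos hε)
  have hw := mem_limitSet.mp h
  -- Two visits near `w`, at times `n < m`: the orbit segment between them is a chain whose ends are
  -- then moved to `w`.
  obtain ⟨n, hn⟩ := (hw.frequently (Metric.ball_mem_nhds w hδ)).exists
  obtain ⟨m, hm, hmn⟩ := ((hw.frequently (Metric.ball_mem_nhds w (half_pos hε))).and_eventually
    (eventually_gt_atTop n)).exists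
  obtain ⟨k, rfl⟩ := Nat.exists_eq_add_of_lt hmn
  have h1 : HasChain f (ε / 2) (f^[n] x) w := by
    refine .of_iterate (n := k) ?_
    rw [← Function.iterate_add_apply]
    rwa [show k + 1 + n = n + k + 1 by ring]
  exact h1.change_head (by rw [dist_comm]; exact H _ hn)

theorem limitSet_nonempty [CompactSpace X] (x : X) : (limitSet f x).Nonempty :=
  nonempty_omegaLimit _ _ _ (singleton_nonempty x)

theorem limitSet_subset_iterate (n : ℕ) (x : X) : limitSet f x ⊆ limitSet f (f^[n] x) := by
  intro w hw
  rw [mem_limitSet, mapClusterPt_def] at hw ⊢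
  rw [← map_add_atTop_eq_nat n, map_map] at hw
  simpa only [Function.comp_def, Function.iterate_add_apply] using hw

theorem limitSet_subset_of_isClosed {A : Set X} (hA : IsClosed A) {x : X}
    (h : ∀ n, f^[n] x ∈ A) : limitSet f x ⊆ A :=
  fun _ hw => hA.mem_of_mapClusterPt (mem_limitSet.mp hw) (.of_forall h)

theorem Node.exists_mem (N : Node f) : N.carrier.Nonempty := by
  obtain ⟨⟨x, hx⟩, rfl⟩ := Quotient.exists_rep N
  exact ⟨x, hx, rfl⟩

theorem Node.upstream {N : Node f} {x y : X} (hx : x ∈ N.carrier) (hy : y ∈ N.carrier) :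
    Upstream f x y := by
  obtain ⟨hx, rfl⟩ := hx
  obtain ⟨hy, h⟩ := hy
  exact (Quotient.exact h).2

theorem Node.mem_of_upstream {N : Node f} {x y : X} (hx : x ∈ N.carrier) (h : Upstream f x y)
    (h' : Upstream f y x) : y ∈ N.carrier := by
  obtain ⟨hx, rfl⟩ := hx
  exact ⟨h'.trans h, Quotient.sound ⟨h', h⟩⟩

theorem Node.eq_of_upstream {N M : Node f} {x y : X} (hx : x ∈ N.carrier) (hy : y ∈ M.carrier)
    (h : Upstream f x y) (h' : Upstream f y x) : N = M := by
  obtain ⟨_, rfl⟩ := Node.mem_of_upstream hx h h'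
  exact hy.2

theorem exists_node_mem {x : X} (hx : Upstream f x x) : ∃ N : Node f, x ∈ N.carrier :=
  ⟨Quotient.mk (chainSetoid f) ⟨x, hx⟩, hx, rfl⟩

theorem Upstream.map_of_self (hf : Continuous f) {x : X} (h : Upstream f x x) :
    Upstream f (f x) x := by
  intro ε hε
  obtain ⟨δ, hδ, H⟩ := Metric.continuous_iff.mp hf (f x) (ε / 2) (half_pos hε)
  rcases (h (min δ (ε / 2)) (lt_min hδ (half_pos hε))).exists_head with h | ⟨z, hz, h⟩
  · have := H x (by rw [dist_comm]; exact h.trans_le (min_le_left _ _))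
    exact (HasChain.single (h.trans_le (min_le_right _ _))).change_head (by rwa [dist_comm])
  · have := H z (by rw [dist_comm]; exact hz.trans_le (min_le_left _ _))
    exact (h.mono (min_le_right _ _)).change_head (by rwa [dist_comm])

theorem Node.map_mem (hf : Continuous f) {N : Node f} {x : X} (hx : x ∈ N.carrier) :
    f x ∈ N.carrier :=
  Node.mem_of_upstream hx (upstream_iterate 0 x) (hx.1.map_of_self hf)

theorem Node.iterate_mem (hf : Continuous f) {N : Node f} {x : X} (hx : x ∈ N.carrier) (n : ℕ) :
    f^[n] x ∈ N.carrier := by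
  induction n with
  | zero => exact hx
  | succ n ih => rw [Function.iterate_succ_apply']; exact Node.map_mem hf ih

theorem Node.isClosed_carrier (hf : Continuous f) (N : Node f) : IsClosed N.carrier := by
  obtain ⟨y, hy⟩ := N.exists_mem
  refine isClosed_of_closure_subset fun x hx => ?_
  rw [Metric.mem_closure_iff] at hx
  refine Node.mem_of_upstream hy (fun ε hε => ?_) fun ε hε => ?_
  · obtain ⟨z, hz, hxz⟩ := hx (ε / 2) (half_pos hε)
    exact (Node.upstream hy hz _ (half_pos hε)).change_tail (by rwa [dist_comm])
  · obtain ⟨δ, hδ, H⟩ := Metric.continuous_iff.mp hf x (ε / 2) (half_pos hε)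
    obtain ⟨z, hz, hxz⟩ := hx δ hδ
    exact (Node.upstream hz hy _ (half_pos hε)).change_head
      (by rw [dist_comm]; exact H z (by rwa [dist_comm]))

theorem Node.limitSet_subset (hf : Continuous f) {N : Node f} {x : X} (hx : x ∈ N.carrier) :
    limitSet f x ⊆ N.carrier :=
  limitSet_subset_of_isClosed (N.isClosed_carrier hf) (Node.iterate_mem hf hx)

theorem conleyGraph_adj_of_iterate_mem (hf : Continuous f) {N M : Node f}
    (h : ∀ ε : ℝ, 0 < ε → ∃ x, ∃ y ∈ N.carrier, dist x y < ε ∧ ∃ n, f^[n] x ∈ M.carrier) :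
    (conleyGraph f).Adj N M := by
  intro ε hε
  obtain ⟨x, y, hy, hxy, n, hn⟩ := h ε hε
  exact ⟨x, ⟨y, hy, hxy⟩, (limitSet_subset_iterate n x).trans (Node.limitSet_subset hf hn)⟩

theorem conleyGraph_adj_self (hf : Continuous f) (N : Node f) : (conleyGraph f).Adj N N := by
  obtain ⟨y, hy⟩ := N.exists_mem
  exact conleyGraph_adj_of_iterate_mem hf
    fun ε hε => ⟨y, y, hy, by simpa using hε, 0, hy⟩

theorem upstream_of_adj [CompactSpace X] (hf : Continuous f) {N M : Node f}
    (h : (conleyGraph f).Adj N M) {x y : X} (hx : x ∈ N.carrier) (hy : y ∈ M.carrier) :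
    Upstream f x y := by
  intro ε hε
  obtain ⟨δ, hδ, H⟩ := Metric.uniformContinuous_iff.mp
    (CompactSpace.uniformContinuous_of_continuous hf) (ε / 2) (half_pos hε)
  obtain ⟨z, ⟨y', hy', hzy'⟩, hz⟩ := h δ hδ
  obtain ⟨w, hw⟩ := limitSet_nonempty (f := f) z
  have h1 : HasChain f ε y' w := (upstream_of_mem_limitSet hw _ (half_pos hε)).change_head
    (H (by rwa [dist_comm]))
  exact ((Node.upstream hx hy' ε hε).trans h1).trans (Node.upstream (hz hw) hy ε hε)

/-- The last step of an `ε`-chain back to `x` puts an image within `ε` of `x`, and the range is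
closed. -/
theorem Node.subset_range [CompactSpace X] (hf : Continuous f) (N : Node f) :
    N.carrier ⊆ range f := by
  intro x hx
  rw [← (isCompact_range hf).isClosed.closure_eq, Metric.mem_closure_iff]
  intro ε hε
  obtain ⟨n, u, -, hn, hu⟩ := hx.1 ε hε
  exact ⟨_, mem_range_self (u n), by rw [dist_comm, ← hn]; exact hu n le_rfl⟩

/-- If the nodes of a continuous map with finitely many nodes are pairwise joined by an edge, its
Conley graph is a tower, and its nodes are linearly ordered by the edges. -/
theorem isTower_of_total [CompactSpace X] [Nonempty X] (hf : Continuous f) [Finite (Node f)]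
    (h : ∀ N M : Node f, N ≠ M → (conleyGraph f).Adj N M ∨ (conleyGraph f).Adj M N) :
    IsTower (conleyGraph f) ∧ ∃ (p : ℕ) (N : Fin (p + 1) ≃ Node f),
      ∀ i j : Fin (p + 1), (conleyGraph f).Adj (N i) (N j) ↔ i ≤ j := by
  classical
  have antisymm : ∀ N M : Node f, (∀ x ∈ N.carrier, ∀ y ∈ M.carrier, Upstream f x y) →
      (∀ x ∈ M.carrier, ∀ y ∈ N.carrier, Upstream f x y) → N = M := by
    intro N M h1 h2
    obtain ⟨x, hx⟩ := N.exists_mem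
    obtain ⟨y, hy⟩ := M.exists_mem
    exact Node.eq_of_upstream hx hy (h1 x hx y hy) (h2 y hy x hx)
  -- Edges always imply chains; totality gives the converse, and with it transitivity of edges.
  have adj_iff : ∀ N M : Node f, (conleyGraph f).Adj N M ↔
      ∀ x ∈ N.carrier, ∀ y ∈ M.carrier, Upstream f x y := by
    refine fun N M => ⟨fun h x hx y hy => upstream_of_adj hf h hx hy, fun hNM => ?_⟩
    by_cases hne : N = M
    · exact hne ▸ conleyGraph_adj_self hf N
    · refine (h N M hne).resolve_right fun hMN => hne (antisymm N M hNM ?_)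
      exact fun x hx y hy => upstream_of_adj hf hMN hx hy
  have trans : ∀ N M K : Node f, (conleyGraph f).Adj N M → (conleyGraph f).Adj M K →
      (conleyGraph f).Adj N K := by
    intro N M K h1 h2
    rw [adj_iff] at *
    obtain ⟨y, hy⟩ := M.exists_mem
    exact fun x hx z hz => (h1 x hx y hy).trans (h2 y hy z hz)
  have antisymm' : ∀ N M : Node f, (conleyGraph f).Adj N M → (conleyGraph f).Adj M N → N = M :=
    fun N M h1 h2 => antisymm N M ((adj_iff N M).mp h1) ((adj_iff M N).mp h2)
  have total : ∀ N M : Node f, (conleyGraph f).Adj N M ∨ (conleyGraph f).Adj M N := by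
    intro N M
    by_cases hne : N = M
    · exact .inl (hne ▸ conleyGraph_adj_self hf N)
    · exact h N M hne
  have reach : ∀ N M : Node f, Relation.ReflTransGen (conleyGraph f).Adj N M →
      (conleyGraph f).Adj N M := by
    intro N M hNM
    induction hNM with
    | refl => exact conleyGraph_adj_self hf N
    | tail _ h1 h2 => exact trans _ _ _ h2 h1
  refine ⟨⟨fun N M h1 h2 => antisymm' N M (reach _ _ h1) (reach _ _ h2), h⟩, ?_⟩
  let _ : LinearOrder (Node f) :=
    { le := (conleyGraph f).Adj
      le_refl := conleyGraph_adj_self hf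
      le_trans := trans
      le_antisymm := antisymm'
      le_total := total
      toDecidableLE := Classical.decRel _ }
  have : Fintype (Node f) := Fintype.ofFinite _
  have : Nonempty (Node f) := by
    obtain ⟨x⟩ := ‹Nonempty X›
    obtain ⟨w, hw⟩ := limitSet_nonempty (f := f) x
    obtain ⟨N, -⟩ := exists_node_mem (upstream_self_of_mem_limitSet hf hw)
    exact ⟨N⟩
  obtain ⟨p, hp⟩ := Nat.exists_eq_succ_of_ne_zero (Fintype.card_ne_zero (α := Node f))
  let e := monoEquivOfFin (Node f) hp
  exact ⟨p, e.toEquiv, fun i j => e.le_iff_le⟩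

end Chains

/-! ### Periodic orbits as attractors and as parts of nodes. -/

section Periodic

variable {X : Type*} [MetricSpace X] {f : X → X}

theorem orbit_eq_image_Iio {X : Type*} {f : X → X} {z : X} {M : ℕ} (hM : 0 < M) (hz : f^[M] z = z) :
    orbit f z = (fun n => f^[n] z) '' Iio M := by
  refine Subset.antisymm ?_ (image_subset_range _ _)
  rintro _ ⟨n, rfl⟩
  exact ⟨n % M, Nat.mod_lt _ hM, Function.IsPeriodicPt.iterate_mod_apply hz n⟩

theorem isClosed_orbit {z : X} (hz : z ∈ Function.periodicPts f) : IsClosed (orbit f z) := by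
  obtain ⟨M, hM, hz⟩ := hz
  rw [orbit_eq_image_Iio hM hz]
  exact ((finite_Iio M).image _).isClosed

theorem limitSet_subset_orbit_of_tendsto (hf : Continuous f) {y z : X} {M : ℕ} (hM : 0 < M)
    (hz : f^[M] z = z) (h : Tendsto (fun j => (f^[M])^[j] y) atTop (𝓝 z)) :
    limitSet f y ⊆ orbit f z := by
  intro w hw
  have hcl : IsClosed (orbit f z) := isClosed_orbit ⟨M, hM, hz⟩
  rw [← hcl.closure_eq, Metric.mem_closure_iff]
  intro ε hε
  -- Convergence along multiples of `M` passes to each of the finitely many residues modulo `M`.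
  have h1 : ∀ r ∈ Iio M, ∀ᶠ j in atTop, dist (f^[r] ((f^[M])^[j] y)) (f^[r] z) < ε / 2 :=
    fun r _ => (((hf.iterate r).tendsto z).comp h).eventually
      (Metric.ball_mem_nhds _ (half_pos hε))
  obtain ⟨J, hJ⟩ := eventually_atTop.mp ((eventually_all_finite (finite_Iio M)).mpr h1)
  obtain ⟨n, hn, hnJ⟩ := (((mem_limitSet.mp hw).frequently
    (Metric.ball_mem_nhds w (half_pos hε))).and_eventually (eventually_ge_atTop (M * J))).exists
  have h2 := hJ (n / M) ((Nat.le_div_iff_mul_le hM).mpr (by rwa [mul_comm])) (n % M)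
    (Nat.mod_lt _ hM)
  rw [← Function.iterate_mul, ← Function.iterate_add_apply, Nat.mod_add_div] at h2
  refine ⟨_, mem_range_self (n % M), ?_⟩
  have h3 : dist (f^[n] y) w < ε / 2 := hn
  rw [dist_comm] at h3
  linarith [dist_triangle w (f^[n] y) (f^[n % M] z)]

/-- Minimality is automatic: a nonempty invariant subset of a cycle is the whole cycle, and the
empty set has empty basin. -/
theorem isAttractor_orbit [CompactSpace X] [MeasurableSpace X] {μ : Measure X} {z : X}
    (hz : z ∈ Function.periodicPts f) (hμ : 0 < μ (basin f (orbit f z))) :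
    IsAttractor μ f (orbit f z) := by
  refine ⟨isClosed_orbit hz, ?_, hμ, ?_⟩
  · rintro _ ⟨n, rfl⟩
    exact ⟨n + 1, Function.iterate_succ_apply' ..⟩
  · rintro ⟨A, hA, -, hmaps, hnull⟩
    obtain rfl | ⟨x, hx⟩ := A.eq_empty_or_nonempty
    · have : basin f (∅ : Set X) = ∅ := eq_empty_of_forall_notMem fun x hx =>
        (limitSet_nonempty x).ne_empty (subset_empty_iff.mp hx)
      rw [this, sdiff_empty] at hnull
      exact hμ.ne' hnull
    · refine hA.2 ?_
      obtain ⟨M, hM, hz⟩ := hz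
      obtain ⟨n, rfl⟩ := hA.1 hx
      rintro _ ⟨m, rfl⟩
      -- The extra `n * (M - 1)` steps complete `n` to the multiple `M * n` of the period.
      have h1 : f^[m + n * (M - 1)] (f^[n] z) = f^[m] z := by
        rw [← Function.iterate_add_apply]
        have h2 : m + n * (M - 1) + n = m + M * n := by
          obtain ⟨k, rfl⟩ := Nat.exists_eq_add_of_lt hM
          simp only [zero_add, Nat.add_sub_cancel]
          ring
        have h3 : f^[M * n] z = z := Function.IsPeriodicPt.mul_const hz n
        rw [h2, Function.iterate_add_apply, h3]
      have h4 := hmaps.iterate (m + n * (M - 1)) hx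
      rwa [h1] at h4

/-- A connected set of periodic points of the same period lies in a single node. -/
theorem upstream_of_isPreconnected {Q : Set X} (hQ : IsPreconnected Q) {M : ℕ} (hM : 0 < M)
    (hfix : ∀ x ∈ Q, f^[M] x = x) {x y : X} (hx : x ∈ Q) (hy : y ∈ Q) : Upstream f x y := by
  intro ε hε
  obtain ⟨n, rfl⟩ := Nat.exists_eq_add_of_lt hM
  rw [zero_add] at hfix
  refine hQ.induction₂' (HasChain f ε) (fun z hz => ?_) (fun _ _ _ _ _ _ => HasChain.trans) hx hy
  filter_upwards [mem_nhdsWithin_of_mem_nhds (Metric.ball_mem_nhds z hε), self_mem_nhdsWithin]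
    with w hw hwQ
  exact ⟨.of_iterate (n := n) (by rwa [hfix z hz, dist_comm]),
    .of_iterate (n := n) (by rwa [hfix w hwQ])⟩

end Periodic

/-! ### Monotonicity away from the preimages of the turning point. -/

section Monotone

variable {X : Type*} [LinearOrder X] [TopologicalSpace X] {f : X → X} {c : X}

theorem iterate_strictMonoOn_or_strictAntiOn (hf : Continuous f)
    (hc : ∀ s : Set X, IsPreconnected s → c ∉ s → StrictMonoOn f s ∨ StrictAntiOn f s)
    {s : Set X} (hs : IsPreconnected s) (hcs : ∀ n, c ∉ f^[n] '' s) (n : ℕ) :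
    StrictMonoOn f^[n] s ∨ StrictAntiOn f^[n] s := by
  induction n with
  | zero => exact .inl fun _ _ _ _ h => h
  | succ n ih =>
    have h := hc _ (hs.image _ (hf.iterate n).continuousOn) (hcs n)
    rw [Function.iterate_succ']
    have hm := mapsTo_image f^[n] s
    rcases h with h | h <;> rcases ih with ih | ih
    · exact .inl (h.comp ih hm)
    · exact .inr (h.comp_strictAntiOn ih hm)
    · exact .inr (h.comp_strictMonoOn ih hm)
    · exact .inl (h.comp ih hm)

/-- If no iterate of the connected set `s` contains the turning point and `f^[m] '' s` meets `s`,
then `f^[2 * m]` is increasing on a connected invariant set containing `s`. -/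
theorem exists_invariant_strictMonoOn [OrderTopology X] (hf : Continuous f)
    (hc : ∀ s : Set X, IsPreconnected s → c ∉ s → StrictMonoOn f s ∨ StrictAntiOn f s)
    {s : Set X} (hs : IsPreconnected s) (hcs : ∀ n, c ∉ f^[n] '' s) {m : ℕ}
    (hm : (s ∩ f^[m] '' s).Nonempty) :
    ∃ t, s ⊆ t ∧ OrdConnected t ∧ MapsTo f^[2 * m] t t ∧ StrictMonoOn f^[2 * m] t := by
  let t : Set X := ⋃ j : ℕ, f^[m * j] '' s
  have ht : IsPreconnected t := by
    refine IsPreconnected.iUnion_of_chain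
      (fun j => hs.image _ (hf.iterate _).continuousOn) fun j => ?_
    obtain ⟨_, hx, y, hy, rfl⟩ := hm
    refine ⟨f^[m * j] (f^[m] y), mem_image_of_mem _ hx, y, hy, ?_⟩
    rw [← Function.iterate_add_apply, Order.succ_eq_add_one, mul_add, mul_one]
  have hct : ∀ n, c ∉ f^[n] '' t := by
    rintro n ⟨x, hx, hxc⟩
    obtain ⟨j, y, hy, rfl⟩ := mem_iUnion.mp hx
    exact hcs (n + m * j) ⟨y, hy, by rw [Function.iterate_add_apply, hxc]⟩
  have hmaps : MapsTo f^[m] t t := by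
    intro x hx
    obtain ⟨j, y, hy, rfl⟩ := mem_iUnion.mp hx
    refine mem_iUnion.mpr ⟨j + 1, y, hy, ?_⟩
    rw [← Function.iterate_add_apply, mul_add, mul_one, add_comm]
  refine ⟨t, fun x hx => mem_iUnion.mpr ⟨0, x, hx, rfl⟩, ht.ordConnected, ?_, ?_⟩
  · rw [two_mul, Function.iterate_add]
    exact hmaps.comp hmaps
  · rw [two_mul, Function.iterate_add]
    -- Doubling `m` makes the iterate increasing even when `f^[m]` is decreasing.
    rcases iterate_strictMonoOn_or_strictAntiOn hf hc ht hct m with h | h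
    · exact h.comp h hmaps
    · exact h.comp h hmaps

end Monotone

/-! ### Dynamics on the interval and edges between nodes. -/

section Interval

variable {a b : ℝ}

theorem dist_le_of_mem_uIcc {u v w : Icc a b} (h : w ∈ uIcc u v) : dist u w ≤ dist u v := by
  have h' : (w : ℝ) ∈ uIcc (u : ℝ) v :=
    (Subtype.mono_coe (Icc a b)).image_uIcc_subset (mem_image_of_mem _ h)
  simpa only [Subtype.dist_eq, Real.dist_eq, abs_sub_comm] using abs_sub_left_of_mem_uIcc h'

theorem exists_tendsto_of_monotone_or_antitone {u : ℕ → Icc a b} (h : Monotone u ∨ Antitone u) :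
    ∃ z, Tendsto u atTop (𝓝 z) := by
  have key : ∃ l : ℝ, Tendsto (fun n => (u n : ℝ)) atTop (𝓝 l) := by
    rcases h with h | h
    · exact ⟨_, tendsto_atTop_ciSup (fun _ _ hij => h hij)
        ⟨b, forall_mem_range.mpr fun n => (u n).2.2⟩⟩
    · exact ⟨_, tendsto_atTop_ciInf (fun _ _ hij => h hij)
        ⟨a, forall_mem_range.mpr fun n => (u n).2.1⟩⟩
  obtain ⟨l, hl⟩ := key
  exact ⟨⟨l, isClosed_Icc.mem_of_tendsto hl (.of_forall fun n => (u n).2)⟩,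
    tendsto_subtype_rng.mpr hl⟩

variable {g : Icc a b → Icc a b} {t : Set (Icc a b)}

/-- The iterates of an increasing map starting in `uIcc x (g x)` have a common limit. -/
theorem exists_tendsto_iterate (hg : Continuous g) (ht : OrdConnected t) (hmaps : MapsTo g t t)
    (hmono : MonotoneOn g t) {x : Icc a b} (hx : x ∈ t) :
    ∃ z, g z = z ∧ ∀ y ∈ uIcc x (g x), Tendsto (fun j => g^[j] y) atTop (𝓝 z) := by
  have hmem : ∀ j, g^[j] x ∈ t := fun j => hmaps.iterate j hx
  have hsub : uIcc x (g x) ⊆ t := ht.uIcc_subset hx (hmaps hx)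
  have hcomp : ∀ j, MonotoneOn g^[j] t := by
    intro j
    induction j with
    | zero => exact fun _ _ _ _ h => h
    | succ j ih => exact ih.comp hmono hmaps
  have hlim : ∃ z, Tendsto (fun j => g^[j] x) atTop (𝓝 z) := by
    rcases le_total x (g x) with h | h
    · exact exists_tendsto_of_monotone_or_antitone <|
        .inl <| monotone_nat_of_le_succ fun j => hcomp j hx (hmaps hx) h
    · exact exists_tendsto_of_monotone_or_antitone <|
        .inr <| antitone_nat_of_succ_le fun j => hcomp j (hmaps hx) hx h
  obtain ⟨z, hz⟩ := hlim
  have hz' : Tendsto (fun j => g^[j + 1] x) atTop (𝓝 z) := hz.comp (tendsto_add_atTop_nat 1)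
  refine ⟨z, ?_, fun y hy => ?_⟩
  · refine tendsto_nhds_unique ?_ hz'
    simp only [Function.iterate_succ_apply']
    exact (hg.tendsto z).comp hz
  · refine hz.congr_dist ?_
    have h0 : Tendsto (fun j => dist (g^[j] x) (g^[j + 1] x)) atTop (𝓝 0) := by
      simpa using hz.dist hz'
    -- The iterates of `y` stay between consecutive iterates of `x`, whose distance tends to zero.
    refine squeeze_zero (fun _ => dist_nonneg) (fun j => dist_le_of_mem_uIcc ?_) h0
    exact ((hcomp j).mono hsub).mapsTo_uIcc hy

theorem not_Icc_subset_basin_orbit {f : Icc a b → Icc a b}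
    (hattr : ∀ x ∈ Function.periodicPts f, ¬ IsAttractor (lebesgue a b) f (orbit f x))
    {z : Icc a b} (hz : z ∈ Function.periodicPts f) {u v : Icc a b} (huv : u < v) :
    ¬ Icc u v ⊆ basin f (orbit f z) := by
  intro h
  refine hattr z hz (isAttractor_orbit hz (lt_of_lt_of_le ?_ (measure_mono h)))
  rw [lebesgue, comap_subtype_coe_apply measurableSet_Icc]
  have himg : Icc (u : ℝ) v ⊆ Subtype.val '' Icc u v :=
    fun x hx => ⟨⟨x, u.2.1.trans hx.1, hx.2.trans v.2.2⟩, hx, rfl⟩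
  refine lt_of_lt_of_le ?_ (measure_mono himg)
  rw [Real.volume_Icc, ENNReal.ofReal_pos]
  exact sub_pos.mpr huv

theorem isPreconnected_of_ordConnected {s : Set (Icc a b)} (hs : OrdConnected s) :
    IsPreconnected s := by
  rw [← Topology.IsInducing.subtypeVal.isPreconnected_image]
  refine OrdConnected.isPreconnected (ordConnected_iff.mpr ?_)
  rintro _ ⟨x, hx, rfl⟩ _ ⟨y, hy, rfl⟩ - w hw
  exact ⟨⟨w, x.2.1.trans hw.1, hw.2.trans y.2.2⟩, hs.out hx hy hw, rfl⟩

theorem isPreconnected_ball (x : Icc a b) (r : ℝ) : IsPreconnected (Metric.ball x r) := by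
  refine isPreconnected_of_ordConnected (ordConnected_iff.mpr fun u hu v hv _ w hw => ?_)
  simp only [Metric.mem_ball, Subtype.dist_eq, Real.dist_eq, abs_lt] at *
  have h1 : (u : ℝ) ≤ w := hw.1
  have h2 : (w : ℝ) ≤ v := hw.2
  constructor <;> linarith

theorem isOpen_connectedComponentIn_of_isOpen {V : Set (Icc a b)} (hV : IsOpen V) (x : Icc a b) :
    IsOpen (connectedComponentIn V x) := by
  refine Metric.isOpen_iff.mpr fun y hy => ?_
  have hyV := connectedComponentIn_subset _ _ hy
  obtain ⟨r, hr, hsub⟩ := Metric.isOpen_iff.mp hV y hyV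
  refine ⟨r, hr, ?_⟩
  rw [connectedComponentIn_eq hy]
  exact (isPreconnected_ball y r).subset_connectedComponentIn (Metric.mem_ball_self hr) hsub

theorem exists_Icc_subset_of_isOpen (hab : a < b) {V : Set (Icc a b)} (hV : IsOpen V)
    {x : Icc a b} (hx : x ∈ V) : ∃ u v, u < v ∧ Icc u v ⊆ V := by
  obtain ⟨r, hr, hsub⟩ := Metric.isOpen_iff.mp hV x hx
  have hord := (isPreconnected_ball x r).ordConnected
  suffices h : ∃ y ∈ Metric.ball x r, y ≠ x by
    obtain ⟨y, hy, hne⟩ := h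
    rcases lt_or_gt_of_ne hne with h | h
    · exact ⟨y, x, h, (hord.out hy (Metric.mem_ball_self hr)).trans hsub⟩
    · exact ⟨x, y, h, (hord.out (Metric.mem_ball_self hr) hy).trans hsub⟩
  obtain ⟨hxa, hxb⟩ := x.2
  rcases hxb.lt_or_eq with h | h
  · refine ⟨⟨min b (x + r / 2), le_min hab.le (by linarith), min_le_left _ _⟩, ?_, ?_⟩
    · rw [Metric.mem_ball, Subtype.dist_eq, Real.dist_eq, abs_lt]
      have := min_le_right b (x + r / 2)
      have : (x : ℝ) ≤ min b (x + r / 2) := le_min hxb (by linarith)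
      constructor <;> dsimp only <;> linarith
    · refine ne_of_gt (Subtype.coe_lt_coe.mp ?_)
      exact lt_min h (by linarith)
  · refine ⟨⟨max a (x - r / 2), le_max_left _ _, max_le hab.le (by linarith)⟩, ?_, ?_⟩
    · rw [Metric.mem_ball, Subtype.dist_eq, Real.dist_eq, abs_lt]
      have := le_max_right a (x - r / 2)
      have : max a (x - r / 2) ≤ (x : ℝ) := max_le hxa (by linarith)
      constructor <;> dsimp only <;> linarith
    · refine ne_of_lt (Subtype.coe_lt_coe.mp ?_)
      exact max_lt (by linarith) (by linarith)

variable {f : Icc a b → Icc a b} {c : Icc a b}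

/-- If no iterate of the connected set `s` contains the turning point and `f^[m] '' s` meets `s`,
then `s` consists of periodic points, unless some periodic orbit attracts. -/
theorem iterate_eq_self_of_turning_notMem (hf : Continuous f)
    (hc : ∀ s : Set (Icc a b), IsPreconnected s → c ∉ s → StrictMonoOn f s ∨ StrictAntiOn f s)
    (hattr : ∀ x ∈ Function.periodicPts f, ¬ IsAttractor (lebesgue a b) f (orbit f x))
    {s : Set (Icc a b)} (hs : IsPreconnected s) (hcs : ∀ n, c ∉ f^[n] '' s) {m : ℕ} (hm0 : 0 < m)
    (hm : (s ∩ f^[m] '' s).Nonempty) {x : Icc a b} (hx : x ∈ s) : f^[2 * m] x = x := by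
  obtain ⟨t, hst, ht, hmaps, hmono⟩ := exists_invariant_strictMonoOn hf hc hs hcs hm
  obtain ⟨z, hz, hlim⟩ := exists_tendsto_iterate (hf.iterate (2 * m)) ht hmaps hmono.monotoneOn
    (hst hx)
  by_contra hne
  have hm1 : 0 < 2 * m := by omega
  -- If `x` moved, the interval between `x` and `f^[2 * m] x` would lie in the basin of a cycle.
  refine not_Icc_subset_basin_orbit hattr (z := z) ⟨2 * m, hm1, hz⟩
    (inf_lt_sup.mpr (Ne.symm hne)) fun y hy => ?_
  exact limitSet_subset_orbit_of_tendsto hf hm1 hz (hlim y hy)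

/-- Arbitrarily close to every node there are preimages of the turning point. -/
theorem exists_iterate_eq_turning (hab : a < b) (hf : Continuous f)
    (hc : ∀ s : Set (Icc a b), IsPreconnected s → c ∉ s → StrictMonoOn f s ∨ StrictAntiOn f s)
    (hattr : ∀ x ∈ Function.periodicPts f, ¬ IsAttractor (lebesgue a b) f (orbit f x))
    (hwand : ∀ J : Set (Icc a b), ¬ IsWanderingInterval f J) (N : Node f) {δ : ℝ} (hδ : 0 < δ) :
    ∃ n x, ∃ y ∈ N.carrier, dist x y < δ ∧ f^[n] x = c := by
  by_contra! hcon
  set V := Metric.thickening δ N.carrier with hV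
  have hVo : IsOpen V := Metric.isOpen_thickening
  have hNV : N.carrier ⊆ V := Metric.self_subset_thickening hδ _
  have hcV : ∀ n, c ∉ f^[n] '' V := by
    rintro n ⟨x, hx, hxc⟩
    obtain ⟨y, hy, hxy⟩ := Metric.mem_thickening_iff.mp hx
    exact hcon n x y hy hxy hxc
  have hcV' : ∀ s, s ⊆ V → ∀ n, c ∉ f^[n] '' s :=
    fun s hs n h => hcV n (image_mono hs h)
  obtain ⟨p, hpN, m, hm, hp⟩ : ∃ p ∈ N.carrier, ∃ m, 0 < m ∧ f^[m] p = p := by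
    obtain ⟨y, hy⟩ := N.exists_mem
    set Q := connectedComponentIn V y with hQ
    have hyQ : y ∈ Q := mem_connectedComponentIn (hNV hy)
    have hQc : IsPreconnected Q := isPreconnected_connectedComponentIn
    have hQV : Q ⊆ V := connectedComponentIn_subset _ _
    obtain ⟨u, v, huv, hsub⟩ := exists_Icc_subset_of_isOpen hab
      (isOpen_connectedComponentIn_of_isOpen hVo y) hyQ
    have h1 : ¬ Pairwise fun k l : ℕ => Disjoint (f^[k] '' Icc u v) (f^[l] '' Icc u v) := by
      refine fun h => hwand (Icc u v) ⟨⟨u, v, huv, rfl⟩, h, ?_⟩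
      rintro ⟨z, hz, hbasin⟩
      exact not_Icc_subset_basin_orbit hattr hz huv hbasin
    obtain ⟨k, m, hmeet⟩ : ∃ k m : ℕ, (f^[k] '' Q ∩ f^[k + m + 1] '' Q).Nonempty := by
      have hsub' : ∀ n, f^[n] '' Icc u v ⊆ f^[n] '' Q := fun n => image_mono hsub
      simp only [Pairwise, not_forall, not_disjoint_iff_nonempty_inter] at h1
      obtain ⟨k, l, hkl, h1⟩ := h1
      rcases lt_or_gt_of_ne hkl with h | h
      · obtain ⟨m, rfl⟩ := Nat.exists_eq_add_of_lt h
        exact ⟨k, m, h1.mono (inter_subset_inter (hsub' _) (hsub' _))⟩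
      · obtain ⟨m, rfl⟩ := Nat.exists_eq_add_of_lt h
        exact ⟨l, m, (inter_comm _ _ ▸ h1).mono (inter_subset_inter (hsub' _) (hsub' _))⟩
    -- The iterate `f^[k] '' Q` may leave `V`; only the periodic point in `N` is kept, and its own
    -- component in `V` is used below.
    refine ⟨f^[k] y, Node.iterate_mem hf hy k, 2 * (m + 1), by omega, ?_⟩
    refine iterate_eq_self_of_turning_notMem hf hc hattr
      (hQc.image _ (hf.iterate k).continuousOn) (fun n => ?_) m.succ_pos ?_
      (mem_image_of_mem _ hyQ)
    · rw [← image_comp, ← Function.iterate_add]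
      exact hcV' Q hQV _
    · rwa [← image_comp, ← Function.iterate_add, Nat.succ_eq_add_one, add_comm (m + 1) k,
        ← add_assoc]
  set Q := connectedComponentIn V p with hQ
  have hpQ : p ∈ Q := mem_connectedComponentIn (hNV hpN)
  have hQc : IsPreconnected Q := isPreconnected_connectedComponentIn
  have hQV : Q ⊆ V := connectedComponentIn_subset _ _
  have hfix : ∀ x ∈ Q, f^[2 * m] x = x := fun x hx =>
    iterate_eq_self_of_turning_notMem hf hc hattr hQc (hcV' Q hQV) hm ⟨p, hpQ, p, hpQ, hp⟩ hx
  have hQN : Q ⊆ N.carrier := fun x hx => Node.mem_of_upstream hpN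
    (upstream_of_isPreconnected hQc (by omega) hfix hpQ hx)
    (upstream_of_isPreconnected hQc (by omega) hfix hx hpQ)
  -- Limit points of `Q` stay in the closed set `N`, hence in `V`, and adjoining one keeps `Q`
  -- connected.
  have hcl : IsClosed Q := by
    refine isClosed_of_closure_subset fun x hx => ?_
    have hxN : x ∈ N.carrier := (N.isClosed_carrier hf).closure_subset_iff.mpr hQN hx
    have hins : insert x Q ⊆ closure Q := insert_subset hx subset_closure
    exact (hQc.subset_closure (subset_insert x Q) hins).subset_connectedComponentIn
      (mem_insert_of_mem _ hpQ) (insert_subset (hNV hxN) hQV) (mem_insert _ _)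
  have : PreconnectedSpace (Icc a b) := ⟨isPreconnected_of_ordConnected ordConnected_univ⟩
  have huniv : Q = univ := IsClopen.eq_univ
    ⟨hcl, isOpen_connectedComponentIn_of_isOpen hVo p⟩ ⟨p, hpQ⟩
  exact hcV 0 ⟨c, hQV (huniv ▸ mem_univ c), rfl⟩

/-- Near a node there are points whose orbits hit any point between the node and the turning
value. -/
theorem conleyGraph_adj_of_mem_uIcc (hf : Continuous f)
    {N M : Node f} {q : Icc a b} (hq : q ∈ M.carrier)
    (hnear : ∀ δ : ℝ, 0 < δ → ∃ n x, ∃ y ∈ N.carrier, dist x y < δ ∧ f^[n] x = c)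
    (hsep : ∀ y ∈ N.carrier, q ∈ uIcc y (f c)) : (conleyGraph f).Adj N M := by
  refine conleyGraph_adj_of_iterate_mem hf fun ε hε => ?_
  obtain ⟨n, x, y, hy, hxy, hxc⟩ := hnear ε hε
  have h1 : q ∈ f^[n + 1] '' uIcc y x := by
    have h2 : IsPreconnected (f^[n + 1] '' uIcc y x) :=
      (isPreconnected_of_ordConnected ordConnected_uIcc).image _ (hf.iterate _).continuousOn
    refine h2.ordConnected.uIcc_subset (mem_image_of_mem _ left_mem_uIcc)
      (mem_image_of_mem _ right_mem_uIcc) ?_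
    rw [Function.iterate_succ_apply' f n x, hxc]
    exact hsep _ (Node.iterate_mem hf hy _)
  obtain ⟨w, hw, hwq⟩ := h1
  refine ⟨w, y, hy, ?_, n + 1, hwq ▸ hq⟩
  rw [dist_comm] at hxy ⊢
  exact (dist_le_of_mem_uIcc hw).trans_lt hxy

/-- The edge points to the node whose extreme point is nearer to `f c`: greatest points are compared
at a maximum, least points at a minimum. -/
theorem conleyGraph_adj_or_adj (hab : a < b) (hf : Continuous f)
    (hc : ∀ s : Set (Icc a b), IsPreconnected s → c ∉ s → StrictMonoOn f s ∨ StrictAntiOn f s)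
    (hext : (∀ x, f x ≤ f c) ∨ ∀ x, f c ≤ f x)
    (hattr : ∀ x ∈ Function.periodicPts f, ¬ IsAttractor (lebesgue a b) f (orbit f x))
    (hwand : ∀ J : Set (Icc a b), ¬ IsWanderingInterval f J) (N M : Node f) :
    (conleyGraph f).Adj N M ∨ (conleyGraph f).Adj M N := by
  have hnear := fun (K : Node f) (δ : ℝ) => exists_iterate_eq_turning hab hf hc hattr hwand K
    (δ := δ)
  have hcomp : ∀ K : Node f, IsCompact K.carrier := fun K => (K.isClosed_carrier hf).isCompact
  rcases hext with hext | hext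
  · have hle : ∀ K : Node f, ∀ x ∈ K.carrier, x ≤ f c := fun K x hx => by
      obtain ⟨y, rfl⟩ := K.subset_range hf hx
      exact hext y
    obtain ⟨p, hp, hpmax⟩ := (hcomp N).exists_isGreatest N.exists_mem
    obtain ⟨q, hq, hqmax⟩ := (hcomp M).exists_isGreatest M.exists_mem
    rcases le_total p q with h | h
    · exact .inl <| conleyGraph_adj_of_mem_uIcc hf hq (hnear N) fun y hy =>
        Icc_subset_uIcc ⟨(hpmax hy).trans h, hle M q hq⟩
    · exact .inr <| conleyGraph_adj_of_mem_uIcc hf hp (hnear M) fun y hy =>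
        Icc_subset_uIcc ⟨(hqmax hy).trans h, hle N p hp⟩
  · have hge : ∀ K : Node f, ∀ x ∈ K.carrier, f c ≤ x := fun K x hx => by
      obtain ⟨y, rfl⟩ := K.subset_range hf hx
      exact hext y
    obtain ⟨p, hp, hpmin⟩ := (hcomp N).exists_isLeast N.exists_mem
    obtain ⟨q, hq, hqmin⟩ := (hcomp M).exists_isLeast M.exists_mem
    rcases le_total p q with h | h
    · exact .inr <| conleyGraph_adj_of_mem_uIcc hf hp (hnear M) fun y hy =>
        Icc_subset_uIcc' ⟨hge N p hp, h.trans (hqmin hy)⟩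
    · exact .inl <| conleyGraph_adj_of_mem_uIcc hf hq (hnear N) fun y hy =>
        Icc_subset_uIcc' ⟨hge M q hq, h.trans (hpmin hy)⟩

theorem IsUnimodal.exists_turning {hab : a < b} (h : IsUnimodal hab f) :
    ∃ c, ((∀ x, f x ≤ f c) ∨ ∀ x, f c ≤ f x) ∧
      ∀ s, IsPreconnected s → c ∉ s → StrictMonoOn f s ∨ StrictAntiOn f s := by
  obtain ⟨c, -, -, h⟩ := h.turning
  have hside : ∀ s, IsPreconnected s → c ∉ s → s ⊆ Iic c ∨ s ⊆ Ici c := by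
    intro s hs hcs
    by_contra! hcon
    obtain ⟨⟨x, hx, hxc⟩, y, hy, hyc⟩ :=
      And.intro (not_subset.mp hcon.1) (not_subset.mp hcon.2)
    exact hcs (hs.ordConnected.out hy hx ⟨(not_le.mp hyc).le, (not_le.mp hxc).le⟩)
  refine ⟨c, ?_, fun s hs hcs => ?_⟩
  · rcases h with ⟨h1, h2⟩ | ⟨h1, h2⟩
    · left
      intro x
      rcases le_total x c with hx | hx
      · exact h1.monotoneOn hx self_mem_Iic hx
      · exact h2.antitoneOn self_mem_Ici hx hx
    · right
      intro x
      rcases le_total x c with hx | hx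
      · exact h1.antitoneOn hx self_mem_Iic hx
      · exact h2.monotoneOn self_mem_Ici hx hx
  · rcases h with ⟨h1, h2⟩ | ⟨h1, h2⟩ <;> rcases hside s hs hcs with h | h
    · exact .inl (h1.mono h)
    · exact .inr (h2.mono h)
    · exact .inr (h1.mono h)
    · exact .inl (h2.mono h)

end Interval

end Conley

theorem mainTheorem2 {a b : ℝ} (hab : a < b) (f : Set.Icc a b → Set.Icc a b)
    (hf : Conley.IsTUnimodal hab f) :
    Finite (Conley.Node f) ∧
    Conley.IsTower (Conley.conleyGraph f) ∧
    ∃ (p : ℕ) (N : Fin (p + 1) ≃ Conley.Node f),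
      ∀ i j : Fin (p + 1), (Conley.conleyGraph f).Adj (N i) (N j) ↔ i ≤ j := by
  have := hf.finite_nodes
  have : Nonempty (Set.Icc a b) := ⟨⟨a, Set.left_mem_Icc.mpr hab.le⟩⟩
  obtain ⟨c, hext, hc⟩ := hf.unimodal.exists_turning
  exact ⟨hf.finite_nodes, Conley.isTower_of_total hf.unimodal.continuous fun N M _ =>
    Conley.conleyGraph_adj_or_adj hab hf.unimodal.continuous hc hext hf.no_attracting_cycle
      hf.no_wandering N M⟩
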